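/- Let $n\ge 0$ and let $A,X,B$ be complex $n\times n$ matrices such that the block matrix $\begin{bmatrix} A & X\\ X^* & B\end{bmatrix}$ is positive semidefinite. Write $|Y|=(Y^*Y)^{1/2}$, let $\circ$ be the entrywise (Schur) product, and for a Hermitian $n\times n$ matrix $M$ let $\lambda_1^{\downarrow}(M)\ge\dots\ge\lambda_n^{\downarrow}(M)$ be its eigenvalues with multiplicity, with $\lambda_i^{\downarrow}(M)=0$ for $i>n$. Then for all nonnegative integers $j$ and $k$, $$\lambda_{1+j+k}^{\downarrow}(|X+X^*|)^2\le \lambda_{1+j}^{\downarrow}(A+B)\,\lambda_{1+k}^{\downarrow}(A+B),$$ $$\lambda_{1+j+k}^{\downarrow}(|X\circ X^*|)^2\le \lambda_{1+j}^{\downarrow}(A\circ B)\,\lambda_{1+k}^{\downarrow}(A\circ B),$$ $$\lambda_{1+j+k}^{\downarrow}(|X-X^*|)^2\le \lambda_{1+j}^{\downarrow}(A+B)\,\lambda_{1+k}^{\downarrow}(A+B).$$ In particular, $\lambda_{2j+1}^{\downarrow}(|X+X^*|)\le\lambda_{j+1}^{\downarrow}(A+B)$ for every nonnegative integer $j$.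 -/

import Mathlib

open scoped Matrix MatrixOrder ComplexOrder

/-- The modulus of a square complex matrix, `CFC.abs Y = (Y* Y)^{1/2}`, is Hermitian. -/
theorem isHermitian_abs {n : ℕ} (Y : Matrix (Fin n) (Fin n) ℂ) : (CFC.abs Y).IsHermitian :=
  (Matrix.nonneg_iff_posSemidef.mp (CFC.abs_nonneg Y)).isHermitian

/-- The `i`-th eigenvalue (counted from `i = 1`) of an `n × n` Hermitian matrix, the eigenvalues
being listed in non-increasing order with multiplicity; it is `0` when `i > n` (and when `i = 0`).
`Matrix.IsHermitian.eigenvalues₀` is Mathlib's non-increasing list of eigenvalues. -/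
noncomputable def eigDesc {n : ℕ} (M : Matrix (Fin n) (Fin n) ℂ) (hM : M.IsHermitian)
    (i : ℕ) : ℝ :=
  if h : 1 ≤ i ∧ i ≤ n then
    hM.eigenvalues₀ ⟨i - 1, by rw [Fintype.card_fin]; omega⟩
  else 0

theorem isHermitian_diag_blocks {n : ℕ} {A X B : Matrix (Fin n) (Fin n) ℂ}
    (h : (Matrix.fromBlocks A X Xᴴ B).PosSemidef) : A.IsHermitian ∧ B.IsHermitian :=
  have h' := Matrix.isHermitian_fromBlocks_iff.mp h.isHermitian
  ⟨h'.1, h'.2.2.2⟩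

theorem isHermitian_blocks_add {n : ℕ} {A X B : Matrix (Fin n) (Fin n) ℂ}
    (h : (Matrix.fromBlocks A X Xᴴ B).PosSemidef) : (A + B).IsHermitian :=
  (isHermitian_diag_blocks h).1.add (isHermitian_diag_blocks h).2

theorem isHermitian_blocks_hadamard {n : ℕ} {A X B : Matrix (Fin n) (Fin n) ℂ}
    (h : (Matrix.fromBlocks A X Xᴴ B).PosSemidef) : (A ⊙ B).IsHermitian :=
  (isHermitian_diag_blocks h).1.hadamard (isHermitian_diag_blocks h).2

/-! Everything follows from `eigDesc_abs_sq_le_of_fromBlocks`, applied to the given block matrix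
plus, Schur-times, or (off-diagonal signs flipped) plus its block swap. That lemma is a dimension
count: some `v ≠ 0` lies in the span of the top `1+j+k` eigenvectors of `|Y|`, is orthogonal to the
top `k` of `Q`, and has `Y v` orthogonal to the top `j` of `P`. With `s`, `p`, `q` the eigenvalues
in question, `s²‖v‖² ≤ ‖Yv‖²`, while Cauchy-Schwarz gives `‖Yv‖⁴ ≤ p‖Yv‖² · q‖v‖²`. -/

open scoped InnerProductSpace

namespace LinearMap.IsSymmetric

variable {E : Type*} [NormedAddCommGroup E] [InnerProductSpace ℂ E] [FiniteDimensional ℂ E]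
  {T : E →ₗ[ℂ] E} {m : ℕ}

theorem inner_eigenvectorBasis_apply (hT : T.IsSymmetric) (hm : Module.finrank ℂ E = m)
    (i : Fin m) (v : E) :
    ⟪hT.eigenvectorBasis hm i, T v⟫_ℂ =
      (hT.eigenvalues hm i : ℂ) * ⟪hT.eigenvectorBasis hm i, v⟫_ℂ := by
  rw [← hT, hT.apply_eigenvectorBasis, inner_smul_left]
  simp

/-- A vector orthogonal to the eigenvectors preceding the `i`-th one has Rayleigh quotient at most
the `i`-th eigenvalue. -/
theorem re_inner_apply_le (hT : T.IsSymmetric) (hm : Module.finrank ℂ E = m) (i : Fin m) (v : E)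
    (hv : ∀ l < i, ⟪hT.eigenvectorBasis hm l, v⟫_ℂ = 0) :
    (⟪v, T v⟫_ℂ).re ≤ hT.eigenvalues hm i * ‖v‖ ^ 2 := by
  rw [← (hT.eigenvectorBasis hm).sum_inner_mul_inner, Complex.re_sum,
    ← (hT.eigenvectorBasis hm).sum_sq_norm_inner_right v, Finset.mul_sum]
  refine Finset.sum_le_sum fun l _ ↦ ?_
  have key : (⟪v, hT.eigenvectorBasis hm l⟫_ℂ * ⟪hT.eigenvectorBasis hm l, T v⟫_ℂ).re =
      hT.eigenvalues hm l * ‖⟪hT.eigenvectorBasis hm l, v⟫_ℂ‖ ^ 2 := by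
    rw [hT.inner_eigenvectorBasis_apply, mul_left_comm, Complex.re_ofReal_mul,
      ← inner_conj_symm v, ← Complex.normSq_eq_conj_mul_self, Complex.ofReal_re,
      Complex.normSq_eq_norm_sq]
  rw [key]
  rcases lt_or_ge l i with hl | hl
  · simp [hv l hl]
  · exact mul_le_mul_of_nonneg_right (hT.eigenvalues_antitone hm hl) (sq_nonneg _)

/-- A vector orthogonal to the eigenvectors following the `i`-th one is stretched by at least
the `i`-th eigenvalue. -/
theorem sq_eigenvalue_mul_le_norm_apply_sq (hT : T.IsSymmetric) (hm : Module.finrank ℂ E = m)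
    (i : Fin m) (hi : 0 ≤ hT.eigenvalues hm i) (v : E)
    (hv : ∀ l, i < l → ⟪hT.eigenvectorBasis hm l, v⟫_ℂ = 0) :
    hT.eigenvalues hm i ^ 2 * ‖v‖ ^ 2 ≤ ‖T v‖ ^ 2 := by
  rw [← (hT.eigenvectorBasis hm).sum_sq_norm_inner_right v,
    ← (hT.eigenvectorBasis hm).sum_sq_norm_inner_right (T v), Finset.mul_sum]
  refine Finset.sum_le_sum fun l _ ↦ ?_
  rw [hT.inner_eigenvectorBasis_apply, norm_mul, mul_pow, Complex.norm_real, Real.norm_eq_abs,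
    sq_abs]
  rcases lt_or_ge i l with hl | hl
  · simp [hv l hl]
  · have := hT.eigenvalues_antitone hm hl
    gcongr

end LinearMap.IsSymmetric

namespace Matrix

variable {n : ℕ}

theorem PosSemidef.eigenvalues₀_nonneg {M : Matrix (Fin n) (Fin n) ℂ} (hM : M.PosSemidef)
    (i : Fin (Fintype.card (Fin n))) : 0 ≤ hM.isHermitian.eigenvalues₀ i := by
  simpa [IsHermitian.eigenvalues] using
    hM.eigenvalues_nonneg (Fintype.equivOfCardEq (Fintype.card_fin _) i)

theorem norm_toEuclideanLin_sq (M : Matrix (Fin n) (Fin n) ℂ) (v : EuclideanSpace ℂ (Fin n)) :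
    ‖toEuclideanLin M v‖ ^ 2 = (star v.ofLp ⬝ᵥ ((Mᴴ * M) *ᵥ v.ofLp)).re := by
  rw [← inner_self_eq_norm_sq (𝕜 := ℂ), EuclideanSpace.inner_eq_star_dotProduct,
    ← mulVec_mulVec, dotProduct_mulVec (star v.ofLp), ← star_mulVec, dotProduct_comm]
  rfl

theorem norm_toEuclideanLin_abs (Y : Matrix (Fin n) (Fin n) ℂ) (v : EuclideanSpace ℂ (Fin n)) :
    ‖toEuclideanLin (CFC.abs Y) v‖ ^ 2 = ‖toEuclideanLin Y v‖ ^ 2 := by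
  rw [norm_toEuclideanLin_sq, norm_toEuclideanLin_sq, (isHermitian_abs Y).eq, CFC.abs_mul_abs,
    star_eq_conjTranspose]

/-- Cauchy-Schwarz for a positive semidefinite block matrix, at the vectors `Y v` and `v`. -/
theorem PosSemidef.norm_sq_sq_le_of_fromBlocks {P Y Q : Matrix (Fin n) (Fin n) ℂ}
    (h : (fromBlocks P Y Yᴴ Q).PosSemidef) (v : EuclideanSpace ℂ (Fin n)) :
    (‖toEuclideanLin Y v‖ ^ 2) ^ 2 ≤
      (⟪toEuclideanLin Y v, toEuclideanLin P (toEuclideanLin Y v)⟫_ℂ).re *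
        (⟪v, toEuclideanLin Q v⟫_ℂ).re := by
  -- This quadratic in `t` is the block form evaluated at `(t • Y v, v)`; its discriminant is
  -- therefore nonpositive.
  have key (t : ℝ) : 0 ≤
      (⟪toEuclideanLin Y v, toEuclideanLin P (toEuclideanLin Y v)⟫_ℂ).re * (t * t) +
        2 * ‖toEuclideanLin Y v‖ ^ 2 * t + (⟪v, toEuclideanLin Q v⟫_ℂ).re := by
    have h0 := h.re_dotProduct_nonneg (Sum.elim ((t : ℂ) • (Y *ᵥ v.ofLp)) v.ofLp)
    have hstar : star (Sum.elim ((t : ℂ) • (Y *ᵥ v.ofLp)) v.ofLp) =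
        Sum.elim ((t : ℂ) • star (Y *ᵥ v.ofLp)) (star v.ofLp) := by
      ext (i | i) <;> simp
    have h1 : star v.ofLp ⬝ᵥ (Yᴴ *ᵥ (Y *ᵥ v.ofLp)) = star (Y *ᵥ v.ofLp) ⬝ᵥ (Y *ᵥ v.ofLp) := by
      rw [dotProduct_mulVec, ← star_mulVec]
    rw [hstar, fromBlocks_mulVec, sumElim_dotProduct_sumElim] at h0
    simp only [Function.comp_def, Sum.elim_inl, Sum.elim_inr] at h0
    have h2 : ‖toEuclideanLin Y v‖ ^ 2 = (star (Y *ᵥ v.ofLp) ⬝ᵥ (Y *ᵥ v.ofLp)).re := by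
      rw [norm_toEuclideanLin_sq, ← mulVec_mulVec, h1]
    rw [h2, EuclideanSpace.inner_eq_star_dotProduct, EuclideanSpace.inner_eq_star_dotProduct,
      dotProduct_comm, dotProduct_comm _ (star v.ofLp)]
    change 0 ≤ (star (Y *ᵥ v.ofLp) ⬝ᵥ (P *ᵥ (Y *ᵥ v.ofLp))).re * (t * t) +
        2 * (star (Y *ᵥ v.ofLp) ⬝ᵥ (Y *ᵥ v.ofLp)).re * t + (star v.ofLp ⬝ᵥ (Q *ᵥ v.ofLp)).re
    simp only [mulVec_smul, dotProduct_add, smul_dotProduct, dotProduct_smul, h1, smul_eq_mul,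
      RCLike.re_eq_complex_re, Complex.add_re, Complex.re_ofReal_mul] at h0
    linarith
  have := discrim_le_zero key
  rw [discrim] at this
  linarith

end Matrix

open Matrix

/-- Three orthogonality conditions of total codimension less than the dimension have a nonzero
common solution. -/
theorem exists_ne_zero_inner_eq_zero {n : ℕ} {ι : Type*} [Fintype ι] (hι : Fintype.card ι < n)
    (φ : ι → EuclideanSpace ℂ (Fin n) →ₗ[ℂ] ℂ) : ∃ v ≠ 0, ∀ i, φ i v = 0 := by
  have hker : LinearMap.ker (LinearMap.pi φ) ≠ ⊥ :=
    LinearMap.ker_ne_bot_of_finrank_lt (by simpa using hι)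
  obtain ⟨v, hv, hv0⟩ := Submodule.exists_mem_ne_zero_of_ne_bot hker
  exact ⟨v, hv0, fun i ↦ congrFun (LinearMap.mem_ker.mp hv) i⟩

theorem eigDesc_nonneg {n : ℕ} {M : Matrix (Fin n) (Fin n) ℂ} (hM : M.PosSemidef) (i : ℕ) :
    0 ≤ eigDesc M hM.isHermitian i := by
  rw [eigDesc]
  split_ifs
  · exact hM.eigenvalues₀_nonneg _
  · exact le_rfl

/-- The singular values of the off-diagonal block of a positive semidefinite block matrix are
controlled by the eigenvalues of the diagonal blocks. -/
theorem eigDesc_abs_sq_le_of_fromBlocks {n : ℕ} {P Y Q : Matrix (Fin n) (Fin n) ℂ}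
    (h : (fromBlocks P Y Yᴴ Q).PosSemidef) (hP : P.IsHermitian) (hQ : Q.IsHermitian) (j k : ℕ) :
    eigDesc (CFC.abs Y) (isHermitian_abs Y) (1 + j + k) ^ 2 ≤
      eigDesc P hP (1 + j) * eigDesc Q hQ (1 + k) := by
  have hP' : P.PosSemidef := h.submatrix Sum.inl
  have hQ' : Q.PosSemidef := h.submatrix Sum.inr
  have hA : (CFC.abs Y).PosSemidef := Matrix.nonneg_iff_posSemidef.mp (CFC.abs_nonneg Y)
  by_cases hn : 1 + j + k ≤ n
  swap
  -- Past `n` the left side is the default value `0`.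
  · have : eigDesc (CFC.abs Y) (isHermitian_abs Y) (1 + j + k) = 0 := dif_neg fun H ↦ hn H.2
    rw [this, zero_pow two_ne_zero]
    exact mul_nonneg (eigDesc_nonneg hP' _) (eigDesc_nonneg hQ' _)
  have hc : Fintype.card (Fin n) = n := Fintype.card_fin n
  let a : Fin (Fintype.card (Fin n)) := ⟨1 + j + k - 1, by omega⟩
  let p : Fin (Fintype.card (Fin n)) := ⟨1 + j - 1, by omega⟩
  let q : Fin (Fintype.card (Fin n)) := ⟨1 + k - 1, by omega⟩
  have ea : eigDesc (CFC.abs Y) (isHermitian_abs Y) (1 + j + k) =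
    (isHermitian_abs Y).eigenvalues₀ a := dif_pos ⟨by omega, hn⟩
  have ep : eigDesc P hP (1 + j) = hP.eigenvalues₀ p := dif_pos ⟨by omega, by omega⟩
  have eq : eigDesc Q hQ (1 + k) = hQ.eigenvalues₀ q := dif_pos ⟨by omega, by omega⟩
  rw [ea, ep, eq]
  have sA := isSymmetric_toEuclideanLin_iff.mpr (isHermitian_abs Y)
  have sP := isSymmetric_toEuclideanLin_iff.mpr hP
  have sQ := isSymmetric_toEuclideanLin_iff.mpr hQ
  -- The conditions number `(n - (1+j+k)) + j + k = n - 1`.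
  obtain ⟨v, hv0, hv⟩ := exists_ne_zero_inner_eq_zero
    (ι := {l // a < l} ⊕ ({l // l < p} ⊕ {l // l < q})) (n := n)
    (by
      simp only [Fintype.card_sum, Fintype.card_subtype, Finset.filter_lt_eq_Ioi,
        Finset.filter_gt_eq_Iio, Fin.card_Ioi, Fin.card_Iio]
      simp only [a, p, q]
      omega)
    (Sum.elim (fun l ↦ (innerₛₗ ℂ (sA.eigenvectorBasis finrank_euclideanSpace l)))
      (Sum.elim
        (fun l ↦ (innerₛₗ ℂ (sP.eigenvectorBasis finrank_euclideanSpace l)) ∘ₗ toEuclideanLin Y)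
        (fun l ↦ (innerₛₗ ℂ (sQ.eigenvectorBasis finrank_euclideanSpace l)))))
  have hvA := sA.sq_eigenvalue_mul_le_norm_apply_sq finrank_euclideanSpace a
    (hA.eigenvalues₀_nonneg a) v fun l hl ↦ hv (.inl ⟨l, hl⟩)
  have hvP := sP.re_inner_apply_le finrank_euclideanSpace p (toEuclideanLin Y v)
    fun l hl ↦ hv (.inr (.inl ⟨l, hl⟩))
  have hvQ := sQ.re_inner_apply_le finrank_euclideanSpace q v
    fun l hl ↦ hv (.inr (.inr ⟨l, hl⟩))
  have hCS := h.norm_sq_sq_le_of_fromBlocks v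
  rw [norm_toEuclideanLin_abs] at hvA
  change (isHermitian_abs Y).eigenvalues₀ a ^ 2 * _ ≤ _ at hvA
  change _ ≤ hP.eigenvalues₀ p * _ at hvP
  change _ ≤ hQ.eigenvalues₀ q * _ at hvQ
  have hp0 : 0 ≤ hP.eigenvalues₀ p := hP'.eigenvalues₀_nonneg p
  have hq0 : 0 ≤ hQ.eigenvalues₀ q := hQ'.eigenvalues₀_nonneg q
  have hv2 : 0 < ‖v‖ ^ 2 := by positivity
  refine le_of_mul_le_mul_right (hvA.trans ?_) hv2
  -- A factor `‖Yv‖²` must be cancelled; if it vanishes, the bound is trivial.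
  rcases (sq_nonneg ‖toEuclideanLin Y v‖).eq_or_lt with hY | hY
  · rw [← hY]
    positivity
  · have hQnn : 0 ≤ (⟪v, toEuclideanLin Q v⟫_ℂ).re := by
      have := hQ'.re_dotProduct_nonneg v.ofLp
      rw [EuclideanSpace.inner_eq_star_dotProduct, dotProduct_comm]
      exact this
    have := hCS.trans (mul_le_mul hvP hvQ hQnn (by positivity))
    refine le_of_mul_le_mul_right ?_ hY
    linarith

theorem Matrix.PosSemidef.fromBlocks_swap {n : ℕ} {A X B : Matrix (Fin n) (Fin n) ℂ}
    (h : (fromBlocks A X Xᴴ B).PosSemidef) : (fromBlocks B Xᴴ X A).PosSemidef := by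
  simpa using h.submatrix Sum.swap

/-- Congruence by `diag(1, -1)`. -/
theorem Matrix.PosSemidef.fromBlocks_neg {n : ℕ} {A X Y B : Matrix (Fin n) (Fin n) ℂ}
    (h : (fromBlocks A X Y B).PosSemidef) : (fromBlocks A (-X) (-Y) B).PosSemidef := by
  simpa [fromBlocks_conjTranspose, fromBlocks_multiply] using
    h.mul_mul_conjTranspose_same (fromBlocks 1 0 0 (-1) : Matrix (Fin n ⊕ Fin n) _ ℂ)

theorem corollary3p1 (n : ℕ) (A X B : Matrix (Fin n) (Fin n) ℂ)
    (h : (Matrix.fromBlocks A X Xᴴ B).PosSemidef) :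
    (∀ j k : ℕ,
      eigDesc (CFC.abs (X + Xᴴ)) (isHermitian_abs _) (1 + j + k) ^ 2 ≤
        eigDesc (A + B) (isHermitian_blocks_add h) (1 + j) *
          eigDesc (A + B) (isHermitian_blocks_add h) (1 + k)) ∧
    (∀ j k : ℕ,
      eigDesc (CFC.abs (X ⊙ Xᴴ)) (isHermitian_abs _) (1 + j + k) ^ 2 ≤
        eigDesc (A ⊙ B) (isHermitian_blocks_hadamard h) (1 + j) *
          eigDesc (A ⊙ B) (isHermitian_blocks_hadamard h) (1 + k)) ∧
    (∀ j k : ℕ,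
      eigDesc (CFC.abs (X - Xᴴ)) (isHermitian_abs _) (1 + j + k) ^ 2 ≤
        eigDesc (A + B) (isHermitian_blocks_add h) (1 + j) *
          eigDesc (A + B) (isHermitian_blocks_add h) (1 + k)) ∧
    (∀ j : ℕ,
      eigDesc (CFC.abs (X + Xᴴ)) (isHermitian_abs _) (2 * j + 1) ≤
        eigDesc (A + B) (isHermitian_blocks_add h) (j + 1)) := by
  have hadd : (fromBlocks (A + B) (X + Xᴴ) (X + Xᴴ)ᴴ (A + B)).PosSemidef := by
    simpa [fromBlocks_add, add_comm] using h.add h.fromBlocks_swap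
  have hsub : (fromBlocks (A + B) (X - Xᴴ) (X - Xᴴ)ᴴ (A + B)).PosSemidef := by
    simpa [fromBlocks_add, add_comm, sub_eq_add_neg] using h.add h.fromBlocks_swap.fromBlocks_neg
  -- The Schur product theorem, applied to the block matrix and its swap.
  have hhad : (fromBlocks (A ⊙ B) (X ⊙ Xᴴ) (X ⊙ Xᴴ)ᴴ (A ⊙ B)).PosSemidef := by
    have heq : fromBlocks (A ⊙ B) (X ⊙ Xᴴ) (X ⊙ Xᴴ)ᴴ (A ⊙ B) =
        fromBlocks A X Xᴴ B ⊙ fromBlocks B Xᴴ X A := by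
      ext (i | i) (j | j) <;> simp [mul_comm]
    exact heq ▸ h.hadamard h.fromBlocks_swap
  refine ⟨eigDesc_abs_sq_le_of_fromBlocks hadd _ _, eigDesc_abs_sq_le_of_fromBlocks hhad _ _,
    eigDesc_abs_sq_le_of_fromBlocks hsub _ _, fun j ↦ ?_⟩
  have hAB : (A + B).PosSemidef := hadd.submatrix Sum.inl
  have := eigDesc_abs_sq_le_of_fromBlocks hadd hAB.isHermitian hAB.isHermitian j j
  rw [← sq, show 1 + j + j = 2 * j + 1 by ring, add_comm 1 j] at this
  exact le_of_sq_le_sq this (eigDesc_nonneg hAB _)
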